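/- Let $\mathbb D=\{z\in\mathbb C:|z|<1\}$. Let $\gamma:\mathrm S^1=\partial\mathbb D\to\mathbb C$ be a continuous, piecewise smooth closed curve whose derivative nowhere vanishes. (Here piecewise smooth means piecewise $C^1$: $[0,2\pi]$ can, up to a shift, be divided into finitely many closed intervals such that $\theta\mapsto\gamma(e^{i\theta})$ is $C^1$ with non-zero derivative on each of them, end points included.) Assume that $\gamma$ is generic: it has finitely many self-intersection points, each of these is a double point (it has exactly two preimages under $\gamma$), and at each of them $\gamma$ is differentiable at both preimages with linearly independent tangent vectors. Assume also that $\gamma$ is self-overlapping: it extends to an immersion of the disk, that is, there is a continuous map $F:\overline{\mathbb D}\to\mathbb C=\mathbb R^2$ with $F|_{\partial\mathbb D}=\gamma$ which is $C^1$ with everywhere invertible differential on $\mathbb D$ and is locally injective on all of $\overline{\mathbb D}$, boundary points included. (The last condition holds automatically if $F$ is $C^1$ with invertible differential up to the boundary.) Then the number of self-intersection points of $\gamma$ is even. -/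

import Mathlib

namespace SelfOverlapping

/-- The closed curve `γ` on the unit circle, written as a `2π`-periodic function of the angle. -/
noncomputable def angular (γ : Circle → ℂ) (θ : ℝ) : ℂ := γ (Circle.exp θ)

/-- `γ` is a continuous, piecewise smooth (that is, piecewise `C¹`) closed curve with nowhere
vanishing derivative: a full period splits into finitely many closed intervals, on each of which
`γ` is `C¹` up to the end points with nonzero derivative (one-sided at the end points). -/
structure IsPiecewiseRegular (γ : Circle → ℂ) : Prop where
  continuous : Continuous γ
  pieces : ∃ (n : ℕ) (a : ℕ → ℝ), 0 < n ∧ (∀ i < n, a i < a (i + 1)) ∧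
    a n = a 0 + 2 * Real.pi ∧
    ∀ i < n, ContDiffOn ℝ 1 (angular γ) (Set.Icc (a i) (a (i + 1))) ∧
      ∀ t ∈ Set.Icc (a i) (a (i + 1)),
        derivWithin (angular γ) (Set.Icc (a i) (a (i + 1))) t ≠ 0

/-- The self-intersection points of `γ`: the points of the plane visited at least twice. -/
def selfIntersections (γ : Circle → ℂ) : Set ℂ :=
  {w | ∃ x y : Circle, x ≠ y ∧ γ x = w ∧ γ y = w}

/-- `γ` is generic: it has finitely many self-intersection points, each of them is a double point,
and at each of them the two branches have tangent vectors and cross transversally. -/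
structure IsGeneric (γ : Circle → ℂ) : Prop where
  finite : (selfIntersections γ).Finite
  double : ∀ w ∈ selfIntersections γ, (γ ⁻¹' {w}).ncard = 2
  transverse : ∀ s t : ℝ, Circle.exp s ≠ Circle.exp t → angular γ s = angular γ t →
    DifferentiableAt ℝ (angular γ) s ∧ DifferentiableAt ℝ (angular γ) t ∧
      LinearIndependent ℝ ![deriv (angular γ) s, deriv (angular γ) t]

/-- `F` is an immersion of the closed unit disk into the plane: it is continuous on the closed
disk, `C¹` with injective differential on the open disk, and locally injective up to the boundary.
At boundary points local injectivity replaces injectivity of the differential, so that the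
boundary curve may have corners; a map that is `C¹` with injective differential up to the boundary
is locally injective. -/
structure IsDiskImmersion (F : ℂ → ℂ) : Prop where
  continuousOn : ContinuousOn F (Metric.closedBall 0 1)
  contDiffOn : ContDiffOn ℝ 1 F (Metric.ball 0 1)
  injective_fderiv : ∀ z ∈ Metric.ball (0 : ℂ) 1, Function.Injective (fderiv ℝ F z)
  locally_injOn : ∀ z ∈ Metric.closedBall (0 : ℂ) 1,
    ∃ U ∈ nhds z, Set.InjOn F (U ∩ Metric.closedBall 0 1)

/-- `γ` is self-overlapping: it extends to an immersion of the disk into the plane. -/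
def IsSelfOverlapping (γ : Circle → ℂ) : Prop :=
  ∃ F : ℂ → ℂ, IsDiskImmersion F ∧ ∀ z : Circle, F z = γ z

end SelfOverlapping

/-! The winding number over one period of the short chord `γ(s + ε) - γ(s)` is found modulo 2 in two
ways. If `γ` bounds a locally injective disk, it is odd: shrinking the circle while spreading each
pair of points until antipodal deforms the chord loop, without zeros, into an antiperiodic loop
(`exists_odd_winding_of_short_chords`). If `γ` has `n` double points, consider the chord function on
`strip`, with the swap `σ(s, t) = (t, s + 2π)`, whose square is translation by a period. The chord
function is odd under `σ`, and its zeros form one `σ`-orbit per double point. Each orbit is divided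
out by an explicit factor, also odd under `σ` and of winding number zero near the diagonal. The
nonvanishing quotient is multiplied by `(-1)^(n+1)` under `σ`, so the winding number is congruent to
`n + 1` (`exists_log_short_chords`). Hence `n` is even. -/

namespace SelfOverlapping

open Filter Topology Complex

/-! ### Continuous logarithms and winding parity. -/

/-- A nonvanishing continuous function on a convex set has a continuous logarithm. -/
theorem exists_continuousOn_log {E : Type*} [NormedAddCommGroup E] [NormedSpace ℝ E] {S : Set E}
    (hS : Convex ℝ S) (hne : S.Nonempty) {f : E → ℂ} (hf : ContinuousOn f S)
    (h0 : ∀ x ∈ S, f x ≠ 0) :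
    ∃ L : E → ℂ, ContinuousOn L S ∧ ∀ x ∈ S, exp (L x) = f x := by
  classical
  obtain ⟨x₀, hx₀⟩ := hne
  have : ContractibleSpace S := hS.contractibleSpace ⟨x₀, hx₀⟩
  have : LocallyPathConnectedSpace S := hS.locallyPathConnectedSpace
  obtain ⟨G, ⟨-, hG⟩, -⟩ := isCoveringMapOn_exp.existsUnique_continuousMap_lifts
    (⟨S.domRestrict f, hf.domRestrict⟩ : C(S, ℂ)) (a₀ := ⟨x₀, hx₀⟩) (e₀ := log (f x₀))
    (exp_log (h0 x₀ hx₀)) (fun a => h0 a a.2)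
  refine ⟨fun x => if h : x ∈ S then G ⟨x, h⟩ else 0, ?_, fun x hx => ?_⟩
  · rw [continuousOn_iff_continuous_domRestrict]
    convert G.continuous using 1
    ext x
    simp
  · have h : exp (G ⟨x, hx⟩) = f x := congrFun hG ⟨x, hx⟩
    simpa only [dif_pos hx] using h

/-- A continuous function on a preconnected set whose exponential is constant is constant. -/
theorem eq_of_exp_eq_const {X : Type*} [TopologicalSpace X] {S : Set X} (hS : IsPreconnected S)
    {f : X → ℂ} (hf : ContinuousOn f S) {c : ℂ} (h : ∀ x ∈ S, exp (f x) = c) {x y : X}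
    (hx : x ∈ S) (hy : y ∈ S) : f x = f y :=
  isCoveringMap_exp.constOn_of_comp hS hf
    (fun a ha b hb => Subtype.ext ((h a ha).trans (h b hb).symm)) hx hy

/-- A nonvanishing loop which is homotopic through nonvanishing loops to an antiperiodic one has
odd winding number. -/
theorem exp_half_winding_eq_neg_one {H : ℝ × ℝ → ℂ} (hH : Continuous H) (h0 : ∀ P, H P ≠ 0)
    (hper : ∀ u s, H (u, s + 2 * Real.pi) = H (u, s)) {u₀ u₁ : ℝ}
    (hodd : ∀ s, H (u₀, s + Real.pi) = -H (u₀, s)) {M : ℝ → ℂ} (hM : Continuous M)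
    (hMH : ∀ s, exp (M s) = H (u₁, s)) : exp ((M (2 * Real.pi) - M 0) / 2) = -1 := by
  obtain ⟨L, hL, hLH⟩ := exists_continuousOn_log convex_univ Set.univ_nonempty
    hH.continuousOn (fun P _ => h0 P)
  rw [continuousOn_univ] at hL
  have hLH' : ∀ P, exp (L P) = H P := fun P => hLH P trivial
  have e1 := eq_of_exp_eq_const (isPreconnected_univ (α := ℝ)) (c := 1)
    (f := fun s => L (u₁, s) - M s) (by fun_prop)
    (fun s _ => by rw [exp_sub, hLH', hMH, div_self (h0 _)])
    (Set.mem_univ (2 * Real.pi)) (Set.mem_univ 0)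
  have e2 := eq_of_exp_eq_const (isPreconnected_univ (α := ℝ)) (c := 1)
    (f := fun u => L (u, 0 + 2 * Real.pi) - L (u, 0)) (by fun_prop)
    (fun u _ => by rw [exp_sub, hLH', hLH', hper, div_self (h0 _)])
    (Set.mem_univ u₁) (Set.mem_univ u₀)
  -- At `u₀` the increment of `L` over each half period is the same logarithm of `-1`, so half the
  -- full increment exponentiates to `-1`.
  have hexp : ∀ s, exp (L (u₀, s + Real.pi) - L (u₀, s)) = -1 := fun s => by
    rw [exp_sub, hLH', hLH', hodd, neg_div, div_self (h0 _)]
  have e3 := eq_of_exp_eq_const (isPreconnected_univ (α := ℝ)) (c := -1)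
    (f := fun s => L (u₀, s + Real.pi) - L (u₀, s)) (by fun_prop)
    (fun s _ => hexp s) (Set.mem_univ (0 + Real.pi)) (Set.mem_univ 0)
  simp only [zero_add] at e1 e2 e3 hexp
  rw [show Real.pi + Real.pi = 2 * Real.pi by ring] at e3
  rw [← hexp 0, zero_add]
  congr 1
  linear_combination (-1 / 2 : ℂ) * e1 + (1 / 2 : ℂ) * e2 + (1 / 2 : ℂ) * e3

/-! ### Short chords on the boundary of an immersed disk. -/

theorem circle_exp_ne_of_lt {s t : ℝ} (h1 : s < t) (h2 : t < s + 2 * Real.pi) :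
    Circle.exp s ≠ Circle.exp t := by
  intro h
  obtain ⟨n, hn⟩ := Circle.exp_eq_exp.1 h.symm
  have hpi := Real.pi_pos
  have n0 : (0 : ℝ) < n := by
    by_contra hc
    nlinarith [mul_nonneg (sub_nonneg.2 (not_lt.1 hc)) hpi.le]
  have n1 : (n : ℝ) < 1 := by
    by_contra hc
    nlinarith [mul_nonneg (sub_nonneg.2 (not_lt.1 hc)) hpi.le]
  have n0' : (0 : ℤ) < n := by exact_mod_cast n0
  have n1' : n < (1 : ℤ) := by exact_mod_cast n1
  omega

/-- A map which is locally injective on a compact set is injective at a uniform scale. -/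
theorem exists_uniform_injOn {α β : Type*} [PseudoMetricSpace α] {K : Set α} (hK : IsCompact K)
    {F : α → β} (h : ∀ z ∈ K, ∃ U ∈ 𝓝 z, Set.InjOn F (U ∩ K)) :
    ∃ δ > 0, ∀ p ∈ K, ∀ q ∈ K, dist q p < δ → F p = F q → p = q := by
  choose! U hU hinj using h
  obtain ⟨V, hV, hVU⟩ := lebesgue_number_lemma_nhds' (U := fun x _ => U x) hK hU
  obtain ⟨δ, hδ, hδV⟩ := Metric.mem_uniformity_dist.1 hV
  refine ⟨δ, hδ, fun p hp q hq hpq hF => ?_⟩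
  obtain ⟨y, hy⟩ := hVU p hp
  refine hinj y y.2 ⟨hy ?_, hp⟩ ⟨hy ?_, hq⟩ hF
  · exact hδV (by simpa using hδ)
  · exact hδV (by rwa [dist_comm])

/-- Short chords of the boundary curve of a locally injective map of the closed disk have odd
winding number. -/
theorem exists_odd_winding_of_short_chords {F : ℂ → ℂ}
    (hF : ContinuousOn F (Metric.closedBall 0 1))
    (hinj : ∀ z ∈ Metric.closedBall (0 : ℂ) 1,
      ∃ U ∈ 𝓝 z, Set.InjOn F (U ∩ Metric.closedBall 0 1)) :
    ∃ ε₀ > 0, ∀ ε : ℝ, 0 < ε → ε < ε₀ → ∀ M : ℝ → ℂ, Continuous M →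
      (∀ s : ℝ, exp (M s) = F (Circle.exp (s + ε)) - F (Circle.exp s)) →
      exp ((M (2 * Real.pi) - M 0) / 2) = -1 := by
  obtain ⟨δ, hδ, hδF⟩ := exists_uniform_injOn (isCompact_closedBall (0 : ℂ) 1) hinj
  refine ⟨min δ Real.pi, lt_min hδ Real.pi_pos, fun ε hε hε₀ M hM hMF => ?_⟩
  obtain ⟨hεδ, hεπ⟩ := lt_min_iff.1 hε₀
  -- The angular gap, clamped to `[ε, π]` so that the homotopy is defined for every real `u`.
  let v : ℝ → ℝ := fun u => max ε (min u Real.pi)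
  have hv : Continuous v := by fun_prop
  have hvε : ∀ u, ε ≤ v u := fun u => le_max_left _ _
  have hvπ : ∀ u, v u ≤ Real.pi := fun u => max_le hεπ.le (min_le_right _ _)
  have hv0 : ∀ u, 0 < v u := fun u => hε.trans_le (hvε u)
  -- Radius `ε / v` keeps points at angular gap `v` within distance `ε < δ`, where `F` separates
  -- them; it is `1` at `v = ε`.
  let p : ℝ × ℝ → ℂ := fun P => ((ε / v P.1 : ℝ) : ℂ) * Circle.exp P.2
  have hp : Continuous p := by
    refine (continuous_ofReal.comp ?_).mul ?_
    · exact continuous_const.div (hv.comp continuous_fst) fun P => (hv0 _).ne'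
    · fun_prop
  have hpK : ∀ P, p P ∈ Metric.closedBall (0 : ℂ) 1 := fun P => by
    simp only [p, mem_closedBall_zero_iff, norm_mul, Circle.norm_coe, mul_one, norm_real,
      Real.norm_eq_abs]
    rw [abs_of_pos (div_pos hε (hv0 _)), div_le_one (hv0 _)]
    exact hvε _
  have hFp : Continuous (F ∘ p) := hF.comp_continuous hp hpK
  have hpper : ∀ u s, p (u, s + 2 * Real.pi) = p (u, s) := fun u s => by
    simp only [p, Circle.periodic_exp s]
  let H : ℝ × ℝ → ℂ := fun P => F (p (P.1, P.2 + v P.1)) - F (p P)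
  have hH : Continuous H := by
    refine Continuous.sub (hFp.comp (f := fun P : ℝ × ℝ => (P.1, P.2 + v P.1)) ?_) hFp
    fun_prop
  refine exp_half_winding_eq_neg_one (H := H) (u₀ := Real.pi) (u₁ := ε) hH ?_ ?_ ?_ hM ?_
  · rintro ⟨u, s⟩ h
    have hsub : p (u, s + v u) - p (u, s) =
        ((ε / v u : ℝ) : ℂ) * Circle.exp s * (exp (I * v u) - 1) := by
      simp only [p, Circle.exp_add, Circle.coe_mul]
      rw [Circle.coe_exp (v u), mul_comm I]
      ring
    have hne : p (u, s) ≠ p (u, s + v u) := by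
      intro he
      rw [he, sub_self] at hsub
      have h1 : (((ε / v u : ℝ) : ℂ)) ≠ 0 := ofReal_ne_zero.2 (div_pos hε (hv0 u)).ne'
      have h2 : exp (I * v u) = 1 := by
        have := mul_eq_zero.1 hsub.symm
        rcases this with h | h
        · exact absurd h (mul_ne_zero h1 (Circle.coe_ne_zero _))
        · exact sub_eq_zero.1 h
      have h3 : Circle.exp (v u) = Circle.exp 0 := by
        ext
        rw [Circle.coe_exp, mul_comm, h2]
        simp
      refine circle_exp_ne_of_lt (hv0 u) ?_ h3.symm
      linarith [hvπ u, Real.pi_pos]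
    refine hne (hδF _ (hpK _) _ (hpK _) ?_ (sub_eq_zero.1 h).symm)
    rw [dist_eq_norm, hsub, norm_mul, norm_mul, Circle.norm_coe, mul_one, norm_real,
      Real.norm_eq_abs, abs_of_pos (div_pos hε (hv0 u))]
    calc ε / v u * ‖exp (I * v u) - 1‖ ≤ ε / v u * ‖v u‖ := by
          gcongr
          exact Real.norm_exp_I_mul_ofReal_sub_one_le
      _ = ε := by rw [Real.norm_eq_abs, abs_of_pos (hv0 u), div_mul_cancel₀ _ (hv0 u).ne']
      _ < δ := hεδ
  · intro u s
    simp only [H]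
    rw [show s + 2 * Real.pi + v u = s + v u + 2 * Real.pi by ring, hpper, hpper]
  · intro s
    have : v Real.pi = Real.pi := by simp [v, hεπ.le]
    simp only [H, this]
    rw [show s + Real.pi + Real.pi = s + 2 * Real.pi by ring, hpper]
    ring
  · intro s
    have : v ε = ε := by simp [v, hεπ.le]
    simp only [H, p, this, div_self hε.ne', ofReal_one, one_mul]
    exact hMF s

/-! ### The local factor of a double point. -/

/-- Two functions vanishing at a point with proportional injective derivatives have a nonzero
limit ratio there. -/
theorem exists_tendsto_div_of_hasFDerivAt {E : Type*} [NormedAddCommGroup E] [NormedSpace ℝ E]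
    [FiniteDimensional ℝ E] {f g : E → ℂ} {A : E →L[ℝ] ℂ} {P : E} {r : ℂ}
    (hA : Function.Injective A) (hr : r ≠ 0) (hf : HasFDerivAt f A P)
    (hg : HasFDerivAt g (r • A) P) (hf0 : f P = 0) (hg0 : g P = 0) :
    ∃ c ≠ 0, Tendsto (fun Q => f Q / g Q) (𝓝[≠] P) (𝓝 c) := by
  have hrA : Function.Injective (r • A) := fun x y h => hA (mul_left_cancel₀ hr (by simpa using h))
  obtain ⟨C, -, hC⟩ := (r • A).toLinearMap.exists_antilipschitzWith (LinearMap.ker_eq_bot.2 hrA)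
  have hne : ∀ᶠ Q in 𝓝[≠] P, g Q ≠ 0 := hg.eventually_ne ⟨C, hC⟩
  have hsub : (fun Q => Q - P) =O[𝓝 P] fun Q => (r • A) (Q - P) :=
    Asymptotics.IsBigO.of_bound C (Eventually.of_forall fun Q => by
      simpa [dist_eq_norm] using hC.le_mul_dist (Q - P) 0)
  have hgo : (fun Q => g Q - (r • A) (Q - P)) =o[𝓝 P] fun Q => Q - P := by
    simpa [hg0] using hg.isLittleO
  have hfo : (fun Q => f Q - A (Q - P)) =o[𝓝 P] fun Q => Q - P := by
    simpa [hf0] using hf.isLittleO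
  -- Injectivity of the derivative bounds `Q - P` by `g`, so errors `o(Q - P)` are also `o(g)`.
  have hO : (fun Q => Q - P) =O[𝓝 P] g := by
    have := (hgo.trans_isBigO hsub).right_isBigO_add
    refine hsub.trans (this.congr_right fun Q => by ring)
  have ho : (fun Q => f Q - r⁻¹ * g Q) =o[𝓝 P] g := by
    refine ((hfo.sub (hgo.const_mul_left r⁻¹)).congr_left fun Q => ?_).trans_isBigO hO
    simp only [_root_.smul_apply, smul_eq_mul]
    field_simp
    ring
  refine ⟨r⁻¹, inv_ne_zero hr, ?_⟩
  have hlim := (ho.tendsto_div_nhds_zero.mono_left (nhdsWithin_le_nhds (s := {P}ᶜ))).add_const r⁻¹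
  rw [zero_add] at hlim
  refine hlim.congr' ?_
  filter_upwards [hne] with Q hQ
  field_simp
  ring

/-- The open strip of pairs of angles `(s, t)` with `s < t < s + 2π`. -/
def strip : Set (ℝ × ℝ) := {P | P.1 < P.2 ∧ P.2 < P.1 + 2 * Real.pi}

/-- The chord of `γ` between two angles. -/
noncomputable def chord (γ : Circle → ℂ) (P : ℝ × ℝ) : ℂ := angular γ P.2 - angular γ P.1

/-- The model for the chord function near a double point: for `c = cos ((b - a) / 2)`,
`m = (a + b) / 2` and non-real `B` it vanishes in the strip exactly at `(a, b)` and its images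
under `(s, t) ↦ (t, s + 2π)`. -/
noncomputable def modelFactor (m c : ℝ) (B : ℂ) (P : ℝ × ℝ) : ℂ :=
  ((Real.cos ((P.2 - P.1) / 2) - c * Real.cos ((P.1 + P.2) / 2 - m) : ℝ) : ℂ) +
    B * (Real.sin ((P.1 + P.2) / 2 - m) : ℝ)

theorem continuous_modelFactor (m c : ℝ) (B : ℂ) : Continuous (modelFactor m c B) := by
  unfold modelFactor
  fun_prop

/-- The swap sends the half difference `ν` to `π - ν` and adds `π` to the mean, so every term
changes sign. -/
theorem modelFactor_swap (m c : ℝ) (B : ℂ) (s t : ℝ) :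
    modelFactor m c B (t, s + 2 * Real.pi) = -modelFactor m c B (s, t) := by
  unfold modelFactor
  simp only
  rw [show (s + 2 * Real.pi - t) / 2 = Real.pi - (t - s) / 2 by ring,
    show (t + (s + 2 * Real.pi)) / 2 - m = ((s + t) / 2 - m) + Real.pi by ring,
    Real.cos_pi_sub, Real.cos_add_pi, Real.sin_add_pi]
  push_cast
  ring

theorem im_modelFactor (m c : ℝ) (B : ℂ) (P : ℝ × ℝ) :
    (modelFactor m c B P).im = B.im * Real.sin ((P.1 + P.2) / 2 - m) := by
  rw [modelFactor, add_im, ofReal_im, mul_im, ofReal_im, ofReal_re]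
  ring

theorem re_modelFactor (m c : ℝ) (B : ℂ) (P : ℝ × ℝ) :
    (modelFactor m c B P).re = Real.cos ((P.2 - P.1) / 2) - c * Real.cos ((P.1 + P.2) / 2 - m) +
      B.re * Real.sin ((P.1 + P.2) / 2 - m) := by
  rw [modelFactor, add_re, ofReal_re, mul_re, ofReal_im, ofReal_re]
  ring

/-- Near the diagonal, whenever the imaginary part vanishes, the real part is at least `cos (ε / 2)
- |c| > 0`. The principal logarithm is therefore continuous there and the factor adds no winding. -/
theorem exists_modelFactor_mem_slitPlane {m c : ℝ} {B : ℂ} (hB : B.im ≠ 0) (hc : |c| < 1) :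
    ∃ ε₀ > 0, ∀ ε : ℝ, 0 < ε → ε < ε₀ → ∀ s, modelFactor m c B (s, s + ε) ∈ slitPlane := by
  have h : ∀ᶠ ε : ℝ in 𝓝 0, |c| < Real.cos (ε / 2) := by
    have hcont : ContinuousAt (fun ε : ℝ => Real.cos (ε / 2)) 0 := by fun_prop
    exact hcont.eventually (lt_mem_nhds (by simpa using hc))
  obtain ⟨ε₀, hε₀, hlt⟩ := Metric.eventually_nhds_iff.1 h
  refine ⟨ε₀, hε₀, fun ε hε hεε₀ s => ?_⟩
  have hcε : |c| < Real.cos (ε / 2) := hlt (by rwa [Real.dist_eq, sub_zero, abs_of_pos hε])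
  rw [mem_slitPlane_iff, im_modelFactor, re_modelFactor]
  by_cases hs : Real.sin ((s + (s + ε)) / 2 - m) = 0
  · left
    simp only
    rw [hs, mul_zero, add_zero, show (s + ε - s) / 2 = ε / 2 by ring]
    have h1 : |c * Real.cos ((s + (s + ε)) / 2 - m)| ≤ |c| := by
      rw [abs_mul]
      exact mul_le_of_le_one_right (abs_nonneg c) (Real.abs_cos_le_one _)
    linarith [le_abs_self (c * Real.cos ((s + (s + ε)) / 2 - m))]
  · exact Or.inr (mul_ne_zero hB hs)

/-- The imaginary part forces the mean to be `(a + b) / 2 + nπ`; injectivity of cosine on `[0, π]`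
then fixes the half difference. The parity of `n` decides whether the end points are swapped. -/
theorem exp_eq_of_modelFactor_eq_zero {a b : ℝ} {B : ℂ} (hB : B.im ≠ 0) (hab : (a, b) ∈ strip)
    {P : ℝ × ℝ} (hP : P ∈ strip)
    (h : modelFactor ((a + b) / 2) (Real.cos ((b - a) / 2)) B P = 0) :
    (Circle.exp P.1 = Circle.exp a ∧ Circle.exp P.2 = Circle.exp b) ∨
      (Circle.exp P.1 = Circle.exp b ∧ Circle.exp P.2 = Circle.exp a) := by
  obtain ⟨h1, h2⟩ := hab
  obtain ⟨h3, h4⟩ := hP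
  simp only at h1 h2
  have him := im_modelFactor ((a + b) / 2) (Real.cos ((b - a) / 2)) B P
  have hre := re_modelFactor ((a + b) / 2) (Real.cos ((b - a) / 2)) B P
  rw [h, zero_im, eq_comm, mul_eq_zero, or_iff_right hB] at him
  rw [h, zero_re, him, mul_zero, add_zero] at hre
  obtain ⟨n, hn⟩ := Real.sin_eq_zero_iff.1 him
  rw [← hn] at hre
  have hpi := Real.pi_pos
  rcases Int.even_or_odd' n with ⟨k, rfl | rfl⟩
  · left
    rw [show ((2 * k : ℤ) : ℝ) * Real.pi = k * (2 * Real.pi) by push_cast; ring,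
      Real.cos_int_mul_two_pi, mul_one, eq_comm, sub_eq_zero] at hre
    have := Real.injOn_cos ⟨by linarith, by linarith⟩ ⟨by linarith, by linarith⟩ hre
    push_cast at hn
    constructor
    · exact Circle.exp_eq_exp.2 ⟨k, by linarith⟩
    · exact Circle.exp_eq_exp.2 ⟨k, by linarith⟩
  · right
    rw [show ((2 * k + 1 : ℤ) : ℝ) * Real.pi = k * (2 * Real.pi) + Real.pi by push_cast; ring,
      Real.cos_add_pi, Real.cos_int_mul_two_pi, mul_neg, mul_one, sub_neg_eq_add, eq_comm,
      add_eq_zero_iff_eq_neg, ← Real.cos_pi_sub] at hre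
    have := Real.injOn_cos ⟨by linarith, by linarith⟩ ⟨by linarith, by linarith⟩ hre
    push_cast at hn
    constructor
    · exact Circle.exp_eq_exp.2 ⟨k, by linarith⟩
    · exact Circle.exp_eq_exp.2 ⟨k + 1, by push_cast; linarith⟩

/-- Points of the strip with the same end points on the circle differ by a common period. -/
theorem eq_add_int_mul_of_exp_eq {a b : ℝ} (hab : (a, b) ∈ strip) {s t : ℝ} (hP : (s, t) ∈ strip)
    (hs : Circle.exp s = Circle.exp a) (ht : Circle.exp t = Circle.exp b) :
    ∃ k : ℤ, s = a + k * (2 * Real.pi) ∧ t = b + k * (2 * Real.pi) := by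
  obtain ⟨h1, h2⟩ := hab
  obtain ⟨h3, h4⟩ := hP
  simp only at h1 h2 h3 h4
  obtain ⟨k, hk⟩ := Circle.exp_eq_exp.1 hs
  obtain ⟨l, hl⟩ := Circle.exp_eq_exp.1 ht
  have hpi := Real.pi_pos
  have e1 : ((l - k : ℤ) : ℝ) < 1 := by
    push_cast
    by_contra hc
    nlinarith [mul_nonneg (sub_nonneg.2 (not_lt.1 hc)) hpi.le]
  have e2 : ((k - l : ℤ) : ℝ) < 1 := by
    push_cast
    by_contra hc
    nlinarith [mul_nonneg (sub_nonneg.2 (not_lt.1 hc)) hpi.le]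
  have e1' : l - k < 1 := by exact_mod_cast e1
  have e2' : k - l < 1 := by exact_mod_cast e2
  obtain rfl : k = l := by omega
  exact ⟨k, hk, hl⟩

theorem swap_mem_strip {s t : ℝ} (h : (s, t) ∈ strip) : (t, s + 2 * Real.pi) ∈ strip := by
  obtain ⟨h1, h2⟩ := h
  simp only at h1 h2
  exact ⟨h2, by simp only; linarith⟩

theorem deriv_angular_add_int_mul (γ : Circle → ℂ) (t : ℝ) (k : ℤ) :
    deriv (angular γ) (t + k * (2 * Real.pi)) = deriv (angular γ) t := by
  rw [← deriv_comp_add_const]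
  congr 1
  ext s
  simp only [angular, Circle.periodic_exp.int_mul k s]

/-- The condition on `B` makes the derivative a complex multiple of `y dt - x ds`, the derivative of
a chord with end velocities `x`, `y`. -/
theorem hasFDerivAt_modelFactor {m c : ℝ} {B x y : ℂ} {P : ℝ × ℝ}
    (hsin : Real.sin ((P.1 + P.2) / 2 - m) = 0) (hxy : x + y ≠ 0)
    (hB : Real.cos ((P.1 + P.2) / 2 - m) * B = Real.sin ((P.2 - P.1) / 2) * (x - y) / (x + y)) :
    HasFDerivAt (modelFactor m c B) ((-(Real.sin ((P.2 - P.1) / 2)) / (x + y) : ℂ) •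
      ((ContinuousLinearMap.snd ℝ ℝ ℝ).smulRight y - (ContinuousLinearMap.fst ℝ ℝ ℝ).smulRight x))
      P := by
  have h1 : HasFDerivAt (fun Q : ℝ × ℝ => Q.1) (ContinuousLinearMap.fst ℝ ℝ ℝ) P := hasFDerivAt_fst
  have h2 : HasFDerivAt (fun Q : ℝ × ℝ => Q.2) (ContinuousLinearMap.snd ℝ ℝ ℝ) P := hasFDerivAt_snd
  have hν := (h2.sub h1).mul_const (2⁻¹ : ℝ)
  have hμ := ((h1.add h2).mul_const (2⁻¹ : ℝ)).sub_const m
  have hre := hν.cos.sub (hμ.cos.const_mul c)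
  have hF := (ofRealCLM.hasFDerivAt.comp P hre).add
    ((ofRealCLM.hasFDerivAt.comp P hμ.sin).const_mul B)
  refine (hF.congr_of_eventuallyEq (Eventually.of_forall fun Q => ?_)).congr_fderiv ?_
  · simp [modelFactor, div_eq_mul_inv]
  · have hμ' : (P.1 + P.2) * 2⁻¹ - m = (P.1 + P.2) / 2 - m := by ring
    have hν' : (P.2 - P.1) * 2⁻¹ = (P.2 - P.1) / 2 := by ring
    have hB' : B * Real.cos ((P.1 + P.2) / 2 - m) =
        Real.sin ((P.2 - P.1) / 2) * (x - y) / (x + y) := by rw [mul_comm, hB]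
    refine ContinuousLinearMap.ext fun v => ?_
    simp only [Pi.add_apply, Pi.sub_apply, hμ', hν', hsin, add_apply, sub_apply, _root_.smul_apply,
      ContinuousLinearMap.comp_apply, ContinuousLinearMap.smulRight_apply,
      ContinuousLinearMap.coe_fst', ContinuousLinearMap.coe_snd', ofRealCLM_apply, smul_eq_mul,
      real_smul]
    push_cast at hB' ⊢
    rw [← mul_assoc B, hB']
    field_simp
    ring

/-- A double point of a generic curve has a factor which captures the zeros of the chord function
lying over it. -/
theorem exists_doublePoint_factor {γ : Circle → ℂ} (hgen : IsGeneric γ) {w : ℂ}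
    (hw : w ∈ selfIntersections γ) :
    ∃ κ : ℝ × ℝ → ℂ, Continuous κ ∧ (∀ s t, κ (t, s + 2 * Real.pi) = -κ (s, t)) ∧
      (∀ P ∈ strip, κ P = 0 → angular γ P.1 = w ∧ angular γ P.2 = w) ∧
      (∀ P ∈ strip, angular γ P.1 = w → angular γ P.2 = w → κ P = 0 ∧
        ∃ c ≠ 0, Tendsto (fun Q => chord γ Q / κ Q) (𝓝[≠] P) (𝓝 c)) ∧
      ∃ ε₀ > 0, ∀ ε : ℝ, 0 < ε → ε < ε₀ → ∀ s, κ (s, s + ε) ∈ slitPlane := by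
  obtain ⟨x, y, hxy, hx, hy⟩ := hw
  have hpi := Real.pi_pos
  obtain ⟨a, rfl⟩ : ∃ a, Circle.exp a = x := ⟨_, Circle.exp_arg x⟩
  obtain ⟨b, rfl, hab⟩ : ∃ b, Circle.exp b = y ∧ (a, b) ∈ strip := by
    obtain ⟨b₀, rfl⟩ : ∃ b, Circle.exp b = y := ⟨_, Circle.exp_arg y⟩
    have hb : Circle.exp (toIocMod Real.two_pi_pos a b₀) = Circle.exp b₀ :=
      Circle.periodic_exp.sub_zsmul_eq _
    obtain ⟨h1, h2⟩ := toIocMod_mem_Ioc Real.two_pi_pos a b₀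
    refine ⟨_, hb, h1, lt_of_le_of_ne h2 fun h => hxy ?_⟩
    simp only at h
    rw [← hb, h, Circle.periodic_exp]
  have hwx : angular γ a = w := hx
  have hwy : angular γ b = w := hy
  have hfib : γ ⁻¹' {w} = {Circle.exp a, Circle.exp b} := by
    symm
    refine Set.eq_of_subset_of_ncard_le ?_ ?_ (Set.finite_of_ncard_ne_zero ?_)
    · rintro z (rfl | rfl)
      exacts [hx, hy]
    · rw [hgen.double w ⟨_, _, hxy, hx, hy⟩, Set.ncard_pair hxy]
    · rw [hgen.double w ⟨_, _, hxy, hx, hy⟩]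
      norm_num
  obtain ⟨hda, hdb, hind⟩ := hgen.transverse a b hxy (hwx.trans hwy.symm)
  set va := deriv (angular γ) a with hva
  set vb := deriv (angular γ) b with hvb
  rw [LinearIndependent.pair_iff] at hind
  have hsum : va + vb ≠ 0 := fun h => by
    have := hind 1 1 (by simpa using h)
    simp at this
  have hν : 0 < (b - a) / 2 ∧ (b - a) / 2 < Real.pi := by
    obtain ⟨h1, h2⟩ := hab
    simp only at h1 h2
    constructor <;> linarith
  have hsν : 0 < Real.sin ((b - a) / 2) := Real.sin_pos_of_pos_of_lt_pi hν.1 hν.2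
  have hc : |Real.cos ((b - a) / 2)| < 1 := by
    rw [abs_lt]
    constructor <;> nlinarith [Real.sin_sq_add_cos_sq ((b - a) / 2)]
  set B : ℂ := Real.sin ((b - a) / 2) * (va - vb) / (va + vb) with hBdef
  -- A real `B` would give a nontrivial real linear relation between `va` and `vb`.
  have hB : B.im ≠ 0 := by
    intro h
    have hBr : B = (B.re : ℂ) := Complex.ext rfl (by simpa using h)
    have h1 : ((Real.sin ((b - a) / 2) - B.re : ℝ) : ℂ) * va +
        ((-Real.sin ((b - a) / 2) - B.re : ℝ) : ℂ) * vb = 0 := by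
      have h2 : (B.re : ℂ) * (va + vb) = Real.sin ((b - a) / 2) * (va - vb) := by
        rw [← hBr, hBdef, div_mul_cancel₀ _ hsum]
      push_cast at h2 ⊢
      linear_combination -h2
    have h3 := hind _ _ (by simpa only [real_smul] using h1)
    linarith [h3.1, h3.2]
  refine ⟨modelFactor ((a + b) / 2) (Real.cos ((b - a) / 2)) B, continuous_modelFactor _ _ _,
    modelFactor_swap _ _ _, fun P hP h0 => ?_, ?_, exists_modelFactor_mem_slitPlane hB hc⟩
  · unfold angular
    rcases exp_eq_of_modelFactor_eq_zero hB hab hP h0 with ⟨h1, h2⟩ | ⟨h1, h2⟩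
    · rw [h1, h2]
      exact ⟨hx, hy⟩
    · rw [h1, h2]
      exact ⟨hy, hx⟩
  · rintro ⟨s, t⟩ hP hs ht
    have hst : Circle.exp s ≠ Circle.exp t := circle_exp_ne_of_lt hP.1 hP.2
    have hs' : Circle.exp s ∈ ({Circle.exp a, Circle.exp b} : Set Circle) := hfib ▸ hs
    have ht' : Circle.exp t ∈ ({Circle.exp a, Circle.exp b} : Set Circle) := hfib ▸ ht
    obtain ⟨hds, hdt, hind'⟩ := hgen.transverse s t hst (hs.trans ht.symm)
    -- `(s, t)` lies in the swap orbit of `(a, b)`. Even iterates preserve the data; odd ones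
    -- exchange `va` and `vb` and make the cosine of the mean `-1`, so the same `B` serves.
    have key : Real.sin ((s + t) / 2 - (a + b) / 2) = 0 ∧
        deriv (angular γ) s + deriv (angular γ) t ≠ 0 ∧
        Real.cos ((s + t) / 2 - (a + b) / 2) * B =
          Real.sin ((t - s) / 2) * (deriv (angular γ) s - deriv (angular γ) t) /
            (deriv (angular γ) s + deriv (angular γ) t) ∧
        Real.cos ((t - s) / 2) =
          Real.cos ((b - a) / 2) * Real.cos ((s + t) / 2 - (a + b) / 2) := by
      rcases hs' with hs' | hs' <;> rcases ht' with ht' | ht'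
      · exact absurd (hs'.trans ht'.symm) hst
      · obtain ⟨k, rfl, rfl⟩ := eq_add_int_mul_of_exp_eq hab hP hs' ht'
        rw [show (a + k * (2 * Real.pi) + (b + k * (2 * Real.pi))) / 2 - (a + b) / 2 =
          k * (2 * Real.pi) by ring, show (b + k * (2 * Real.pi) - (a + k * (2 * Real.pi))) / 2 =
          (b - a) / 2 by ring, deriv_angular_add_int_mul, deriv_angular_add_int_mul,
          Real.cos_int_mul_two_pi]
        refine ⟨?_, hsum, ?_, by ring⟩
        · simpa using (Real.sin_periodic.int_mul k) 0
        · rw [ofReal_one, one_mul]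
      · obtain ⟨k, rfl, rfl⟩ := eq_add_int_mul_of_exp_eq (swap_mem_strip hab) hP hs'
          (ht'.trans (Circle.periodic_exp a).symm)
        rw [show (b + k * (2 * Real.pi) + (a + 2 * Real.pi + k * (2 * Real.pi))) / 2 - (a + b) / 2 =
          k * (2 * Real.pi) + Real.pi by ring,
          show (a + 2 * Real.pi + k * (2 * Real.pi) - (b + k * (2 * Real.pi))) / 2 =
          Real.pi - (b - a) / 2 by ring,
          show a + 2 * Real.pi + k * (2 * Real.pi) = a + (k + 1 : ℤ) * (2 * Real.pi) by
            push_cast; ring, deriv_angular_add_int_mul, deriv_angular_add_int_mul,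
          Real.cos_add_pi, Real.sin_add_pi, Real.cos_int_mul_two_pi, Real.sin_pi_sub,
          Real.cos_pi_sub, ← hva, ← hvb, add_comm vb va]
        refine ⟨?_, hsum, ?_, by ring⟩
        · simpa using (Real.sin_periodic.int_mul k) 0
        · rw [hBdef]
          push_cast
          ring
      · exact absurd (hs'.trans ht'.symm) hst
    obtain ⟨hsin, hne, hB', hcos⟩ := key
    have h0 : modelFactor ((a + b) / 2) (Real.cos ((b - a) / 2)) B (s, t) = 0 := by
      simp only [modelFactor, hsin, hcos]
      simp
    refine ⟨h0, exists_tendsto_div_of_hasFDerivAt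
      (A := (ContinuousLinearMap.snd ℝ ℝ ℝ).smulRight (deriv (angular γ) t) -
        (ContinuousLinearMap.fst ℝ ℝ ℝ).smulRight (deriv (angular γ) s)) ?_ ?_ ?_
      (hasFDerivAt_modelFactor hsin hne hB') ?_ h0⟩
    · refine (injective_iff_map_eq_zero _).2 fun v hv => ?_
      rw [LinearIndependent.pair_iff] at hind'
      have := hind' (-v.1) v.2 (by simpa [sub_eq_neg_add] using hv)
      exact Prod.ext (neg_eq_zero.1 this.1) this.2
    · refine div_ne_zero (neg_ne_zero.2 (ofReal_ne_zero.2 ?_)) hne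
      have h1 := hP.1
      have h2 := hP.2
      simp only at h1 h2
      exact (Real.sin_pos_of_pos_of_lt_pi (by simp only; linarith) (by simp only; linarith)).ne'
    · have e1 := HasFDerivAt.comp (s, t) (f := Prod.fst) hds.hasDerivAt.hasFDerivAt
        (hasFDerivAt_fst (𝕜 := ℝ))
      have e2 := HasFDerivAt.comp (s, t) (f := Prod.snd) hdt.hasDerivAt.hasFDerivAt
        (hasFDerivAt_snd (𝕜 := ℝ))
      refine (e2.sub e1).congr_fderiv (ContinuousLinearMap.ext fun v => ?_)
      simp
    · exact sub_eq_zero.2 (ht.trans hs.symm)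

/-! ### Factoring the chord function on the strip. -/

theorem isOpen_strip : IsOpen strip :=
  (isOpen_lt continuous_fst continuous_snd).inter
    (isOpen_lt continuous_snd (continuous_fst.add continuous_const))

theorem convex_strip : Convex ℝ strip := by
  rintro ⟨s, t⟩ ⟨h1, h2⟩ ⟨s', t'⟩ ⟨h3, h4⟩ a b ha hb hab
  simp only at h1 h2 h3 h4
  obtain rfl : b = 1 - a := by linarith
  constructor
  · simp only [Prod.smul_mk, Prod.mk_add_mk, smul_eq_mul]
    rcases ha.eq_or_lt with rfl | ha
    · linarith
    · nlinarith [mul_lt_mul_of_pos_left h1 ha, mul_le_mul_of_nonneg_left h3.le hb]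
  · simp only [Prod.smul_mk, Prod.mk_add_mk, smul_eq_mul]
    rcases ha.eq_or_lt with rfl | ha
    · linarith
    · nlinarith [mul_lt_mul_of_pos_left h2 ha, mul_le_mul_of_nonneg_left h4.le hb]

/-- If the ratio of two continuous functions has a nonzero limit at each of their common zeros,
then it extends to a nonvanishing continuous function. -/
theorem exists_continuousOn_ratio {X : Type*} [TopologicalSpace X] {S : Set X}
    {g k : X → ℂ} (hg : Continuous g) (hk : Continuous k) (h0 : ∀ P ∈ S, g P ≠ 0 → k P ≠ 0)
    (hlim : ∀ P ∈ S, g P = 0 →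
      k P = 0 ∧ ∃ c ≠ 0, Tendsto (fun Q => g Q / k Q) (𝓝[≠] P) (𝓝 c)) :
    ∃ U : X → ℂ, ContinuousOn U S ∧ (∀ P ∈ S, U P ≠ 0) ∧ ∀ P ∈ S, g P = U P * k P := by
  classical
  choose! hk0 c hc hlim using hlim
  refine ⟨fun P => if g P = 0 then c P else g P / k P, fun P hP => ?_, fun P hP => ?_,
    fun P hP => ?_⟩
  · refine ContinuousAt.continuousWithinAt ?_
    by_cases hgP : g P = 0
    · rw [continuousAt_iff_punctured_nhds]
      simp only [hgP, if_true]
      refine (hlim P hP hgP).congr' ?_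
      filter_upwards [(hlim P hP hgP).eventually_ne (hc P hP hgP)] with Q hQ
      rw [if_neg]
      rintro h
      simp [h] at hQ
    · refine (hg.continuousAt.div hk.continuousAt (h0 P hP hgP)).congr ?_
      filter_upwards [hg.continuousAt.eventually_ne hgP] with Q hQ
      simp [hQ]
  · simp only
    split_ifs with h
    · exact hc P hP h
    · exact div_ne_zero h (h0 P hP h)
  · simp only
    split_ifs with h
    · rw [h, hk0 P hP h, mul_zero]
    · rw [div_mul_cancel₀ _ (h0 P hP h)]

/-- The short chords of a generic curve have a logarithm whose half variation over a period is
determined by the parity of the number of double points. -/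
theorem exists_log_short_chords {γ : Circle → ℂ} (hγ : Continuous γ) (hgen : IsGeneric γ) :
    ∃ ε₀ > 0, ∀ ε : ℝ, 0 < ε → ε < ε₀ → ∃ M : ℝ → ℂ, Continuous M ∧
      (∀ s : ℝ, exp (M s) = γ (Circle.exp (s + ε)) - γ (Circle.exp s)) ∧
      exp ((M (2 * Real.pi) - M 0) / 2) = (-1) ^ ((selfIntersections γ).ncard + 1) := by
  classical
  choose! κ hκc hκσ hκz hκl hκs using fun w (hw : w ∈ selfIntersections γ) =>
    exists_doublePoint_factor hgen hw
  choose! δ hδ hκs using hκs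
  set Z := hgen.finite.toFinset
  have hZm : ∀ {w}, w ∈ Z ↔ w ∈ selfIntersections γ := hgen.finite.mem_toFinset
  have hcard : (selfIntersections γ).ncard = Z.card := Set.ncard_eq_toFinset_card _ hgen.finite
  have hang : Continuous (angular γ) := hγ.comp Circle.exp.continuous
  have hper : ∀ s, angular γ (s + 2 * Real.pi) = angular γ s := fun s =>
    congrArg γ (Circle.periodic_exp s)
  have hg : Continuous (chord γ) := (hang.comp continuous_snd).sub (hang.comp continuous_fst)
  let K : ℝ × ℝ → ℂ := fun P => ∏ w ∈ Z, κ w P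
  have hK : Continuous K := continuous_finsetProd _ fun w hw => hκc w (hZm.1 hw)
  have hKσ : ∀ s t, K (t, s + 2 * Real.pi) = (-1) ^ Z.card * K (s, t) := fun s t => by
    simp only [K]
    rw [← Finset.prod_const, ← Finset.prod_mul_distrib]
    exact Finset.prod_congr rfl fun w hw => by rw [hκσ w (hZm.1 hw), neg_one_mul]
  have hgσ : ∀ s t, chord γ (t, s + 2 * Real.pi) = -chord γ (s, t) := fun s t => by
    simp only [chord, hper, neg_sub]
  have hlim : ∀ P ∈ strip, chord γ P = 0 →
      K P = 0 ∧ ∃ c ≠ 0, Tendsto (fun Q => chord γ Q / K Q) (𝓝[≠] P) (𝓝 c) := by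
    intro P hP h
    have heq : angular γ P.2 = angular γ P.1 := sub_eq_zero.1 h
    have hw : angular γ P.1 ∈ Z :=
      hZm.2 ⟨_, _, circle_exp_ne_of_lt hP.1 hP.2, rfl, heq⟩
    set w := angular γ P.1
    obtain ⟨h0, c, hc, hcl⟩ := hκl w (hZm.1 hw) P hP rfl heq
    -- The other factors vanish only over other double points.
    have hrest : ∏ v ∈ Z.erase w, κ v P ≠ 0 := Finset.prod_ne_zero_iff.2 fun v hv hv0 =>
      Finset.ne_of_mem_erase hv (hκz v (hZm.1 (Finset.mem_of_mem_erase hv)) P hP hv0).1.symm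
    refine ⟨Finset.prod_eq_zero hw h0, c / ∏ v ∈ Z.erase w, κ v P, div_ne_zero hc hrest, ?_⟩
    have hcont : Continuous fun Q => ∏ v ∈ Z.erase w, κ v Q :=
      continuous_finsetProd _ fun v hv => hκc v (hZm.1 (Finset.mem_of_mem_erase hv))
    refine (hcl.div (hcont.continuousAt.mono_left nhdsWithin_le_nhds) hrest).congr fun Q => ?_
    simp only [K, Pi.div_apply]
    rw [← Finset.mul_prod_erase Z _ hw, div_div]
  obtain ⟨U, hU, hU0, hUK⟩ := exists_continuousOn_ratio hg hK (fun P hP h hKP => by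
    obtain ⟨w, hw, h0⟩ := Finset.prod_eq_zero_iff.1 hKP
    obtain ⟨h1, h2⟩ := hκz w (hZm.1 hw) P hP h0
    exact h (sub_eq_zero.2 (h2.trans h1.symm))) hlim
  have hne : strip.Nonempty := ⟨(0, Real.pi), Real.pi_pos, by simp only; linarith [Real.pi_pos]⟩
  obtain ⟨L, hL, hLU⟩ := exists_continuousOn_log convex_strip hne hU hU0
  let σ : ℝ × ℝ → ℝ × ℝ := fun P => (P.2, P.1 + 2 * Real.pi)
  have hσ : Continuous σ := by fun_prop
  have hσS : Set.MapsTo σ strip strip := fun P hP => swap_mem_strip hP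
  let D : ℝ × ℝ → ℂ := fun P => L (σ P) - L P
  have hD : ContinuousOn D strip := (hL.comp hσ.continuousOn hσS).sub hL
  have hDne : ∀ P ∈ strip, chord γ P ≠ 0 → exp (D P) = (-1) ^ (Z.card + 1) := by
    intro P hP h
    have e1 := hUK P hP
    have e2 := hUK (σ P) (hσS hP)
    rw [show chord γ (σ P) = -chord γ P from hgσ _ _,
      show K (σ P) = (-1) ^ Z.card * K P from hKσ _ _, e1] at e2
    have hK0 : K P ≠ 0 := fun h' => h (by rw [e1, h', mul_zero])
    rw [exp_sub, hLU _ hP, hLU _ (hσS hP), div_eq_iff (hU0 P hP)]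
    have e3 : -U P = U (σ P) * (-1) ^ Z.card := mul_right_cancel₀ hK0 (by linear_combination e2)
    have e4 : ((-1 : ℂ) ^ Z.card) * (-1) ^ Z.card = 1 := by
      rw [← mul_pow]
      norm_num
    rw [pow_succ]
    linear_combination (-(-1 : ℂ) ^ Z.card) * e3 - U (σ P) * e4
  -- Zeros of the chord function in the strip are isolated, so the identity extends to them by
  -- continuity.
  have hDexp : ∀ P ∈ strip, exp (D P) = (-1) ^ (Z.card + 1) := by
    intro P hP
    by_cases h : chord γ P = 0
    · obtain ⟨-, c, hc, hcl⟩ := hlim P hP h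
      have hcont : Tendsto (fun Q => exp (D Q)) (𝓝[≠] P) (𝓝 (exp (D P))) :=
        (hD.continuousAt (isOpen_strip.mem_nhds hP)).cexp.mono_left nhdsWithin_le_nhds
      refine tendsto_nhds_unique hcont (tendsto_const_nhds.congr' ?_)
      filter_upwards [hcl.eventually_ne hc, nhdsWithin_le_nhds (isOpen_strip.mem_nhds hP)]
        with Q hQ hQS
      exact (hDne Q hQS fun h' => hQ (by rw [h', zero_div])).symm
    · exact hDne P hP h
  obtain ⟨ε₀, hε₀, hεκ⟩ : ∃ ε₀ > 0, ∀ w ∈ Z, ε₀ ≤ δ w := by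
    rcases Z.eq_empty_or_nonempty with h | h
    · exact ⟨1, one_pos, by simp [h]⟩
    · exact ⟨Z.inf' h δ, (Finset.lt_inf'_iff h).2 fun w hw => hδ w (hZm.1 hw),
        fun w hw => Finset.inf'_le δ hw⟩
  refine ⟨min ε₀ Real.pi, lt_min hε₀ Real.pi_pos, fun ε hε hlt => ?_⟩
  obtain ⟨hlt1, hlt2⟩ := lt_min_iff.1 hlt
  have hmem : ∀ s : ℝ, (s, s + ε) ∈ strip := fun s =>
    ⟨by simpa using hε, by simp only; linarith [Real.pi_pos]⟩
  have hslit : ∀ w ∈ Z, ∀ s, κ w (s, s + ε) ∈ slitPlane := fun w hw s =>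
    hκs w (hZm.1 hw) ε hε (hlt1.trans_le (hεκ w hw)) s
  refine ⟨fun s => L (s, s + ε) + ∑ w ∈ Z, log (κ w (s, s + ε)), ?_, fun s => ?_, ?_⟩
  · refine (hL.comp_continuous (by fun_prop) hmem).add (continuous_finsetSum _ fun w hw => ?_)
    exact ((hκc w (hZm.1 hw)).comp (by fun_prop : Continuous fun s : ℝ => (s, s + ε))).clog
      (hslit w hw)
  · rw [exp_add, exp_sum, hLU _ (hmem s),
      Finset.prod_congr rfl fun w hw => exp_log (slitPlane_ne_zero (hslit w hw s))]
    exact (hUK _ (hmem s)).symm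
  · have hsum : ∑ w ∈ Z, log (κ w (2 * Real.pi, 2 * Real.pi + ε)) =
        ∑ w ∈ Z, log (κ w (0, 0 + ε)) := Finset.sum_congr rfl fun w hw => by
      have h := hκσ w (hZm.1 hw)
      rw [show κ w (2 * Real.pi, 2 * Real.pi + ε) = κ w (0 + 2 * Real.pi, ε + 2 * Real.pi) by
        rw [zero_add, add_comm ε], h, h, neg_neg, zero_add]
    -- `D` is constant and `σ ∘ σ` is a period translation, so the increment of `L` over a period is
    -- `2 D`.
    have hconst := eq_of_exp_eq_const convex_strip.isPreconnected hD hDexp (hmem 0)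
      (hσS (hmem 0))
    beta_reduce
    rw [hsum, hcard, ← hDexp _ (hmem 0)]
    congr 1
    have e : L (σ (σ (0, 0 + ε))) = L (2 * Real.pi, 2 * Real.pi + ε) := by
      simp only [σ, zero_add, add_comm ε]
    simp only [D] at hconst ⊢
    rw [e] at hconst
    linear_combination (-1 / 2 : ℂ) * hconst

end SelfOverlapping

theorem mainTheorem7 (γ : Circle → ℂ) (hreg : SelfOverlapping.IsPiecewiseRegular γ)
    (hgen : SelfOverlapping.IsGeneric γ) (hso : SelfOverlapping.IsSelfOverlapping γ) :
    Even (SelfOverlapping.selfIntersections γ).ncard := by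
  obtain ⟨F, hF, hFγ⟩ := hso
  obtain ⟨ε₁, hε₁, h1⟩ := SelfOverlapping.exists_odd_winding_of_short_chords hF.continuousOn
    hF.locally_injOn
  obtain ⟨ε₂, hε₂, h2⟩ := SelfOverlapping.exists_log_short_chords hreg.continuous hgen
  obtain ⟨ε, hε, hlt⟩ := exists_between (lt_min hε₁ hε₂)
  obtain ⟨hlt1, hlt2⟩ := lt_min_iff.1 hlt
  obtain ⟨M, hM, hMγ, hMe⟩ := h2 ε hε hlt2
  have h := h1 ε hε hlt1 M hM fun s => by rw [hMγ, hFγ, hFγ]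
  rw [hMe] at h
  rcases Nat.even_or_odd (SelfOverlapping.selfIntersections γ).ncard with he | ho
  · exact he
  · rw [ho.add_one.neg_one_pow] at h
    norm_num at h
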